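/- **Conventions.** Complexes are finite abstract simplicial complexes; the empty simplex (of dimension $-1$) is counted as a simplex. $S_d(K)$ is the set of $d$-dimensional simplices, and $F\in\partial\bar F$ means that $F$ is a codimension-one face of $\bar F$. Face weights $w$ are positive reals on all simplices, and $C^d$ carries the inner product $\langle f,g\rangle=\sum_{F\in S_d}w(F)f([F])\overline{g([F])}$. For nonzero complex weights $\omega(F,\bar F)$ on the incidences $F\in\partial\bar F$ put $$(\delta^\omega_{d} f)([v_0,\dots,v_{d+1}])=\sum_{j}(-1)^j\,\omega(\{v_0,\dots,\hat v_j,\dots,v_{d+1}\},\{v_0,\dots,v_{d+1}\})\,f([v_0,\dots,\hat v_j,\dots,v_{d+1}]),$$ and $\mathcal L_i^{\mathrm{down}}(M,\omega)=\delta^\omega_{i-1}(\delta^\omega_{i-1})^*$ on $C^i(M,\mathbb C)$; $\mathcal L_i^{\mathrm{down}}(K)$ is the case $\omega\equiv1$ on real cochains. $\operatorname{Spec}$ is the multiset of eigenvalues with algebraic multiplicity. A *covering* $\phi:K\to M$ is a simplicial map with $K$ connected such that for each $G\in M$ the simplices $F\in K$ with $\phi(F)=G$ are pairwise disjoint, are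 mapped bijectively onto $G$, and together contain all vertices of $K$ lying over $G$, and such that whenever $G\in\partial\bar G$ in $M$ and $\phi(F)=G$ there is $\bar F\in K$ with $F\in\partial\bar F$ and $\phi(\bar F)=\bar G$ (strong covering). It is *$k$-fold* ($k\ge1$) if over each nonempty simplex of $M$ there are exactly $k$ simplices of $K$. $B_{i-1}(K)$ is the bipartite graph on $S_{i-1}(K)\cup S_i(K)$ with edges $\{F,\bar F\}$ for $F\in\partial\bar F$. A permutation assignment $\psi$ on $B_{i-1}(M)$ gives each arc $e$ an element of the symmetric group $\mathbb S_k$ with $\psi(e^{-1})=\psi(e)^{-1}$; the derived graph $B_{i-1}(M)^\psi$ has vertices $(u,a)$, $a\in[k]$, and $(u,a)\sim(v,b)$ iff $\{u,v\}$ is an edge and $a=\psi(u,v)(b)$. **Theorem.** Let $i\ge0$, let $\phi:K\to M$ be a $k$-fold covering, and let $w_K(F)=w_M(\phi(F))$ for all $F\in S_{i-1}(K)\cup S_i(K)$. Let $\psi$ be a permutation assignment on $B_{i-1}(M)$ with an isomorphism $\eta:B_{i-1}(M)^\psi\to B_{i-1}(K)$ satisfying $\phi(\eta(G,a))=G$ for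 all $(G,a)$, and suppose that the voltage group $\Psi_{i-1}=\langle\psi(G,\bar G): G\in\partial\bar G,\ \bar G\in S_i(M)\rangle\le\mathbb S_k$ is abelian. Then the permutation representation $\varrho$ of $\Psi_{i-1}$ on $\mathbb C^k$ has a decomposition $\varrho=1\oplus\varrho_2\oplus\cdots\oplus\varrho_k$ into representations of degree one, and for every such decomposition, as multisets, $$\operatorname{Spec}\mathcal L_i^{\mathrm{down}}(K)=\operatorname{Spec}\mathcal L_i^{\mathrm{down}}(M)\ \cup\ \bigcup_{j=2}^k\operatorname{Spec}\mathcal L_i^{\mathrm{down}}(M,\omega_j),\qquad \omega_j(F,\bar F)=\varrho_j(\psi(F,\bar F))\ \text{ for } F\in\partial\bar F,\ \bar F\in S_i(M).$$ -/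

import Mathlib

open Finset

noncomputable section

namespace CoverSpec

/-! ### Faces of a finite complex, the empty face included -/

section Faces

set_option linter.unusedSectionVars false

variable {V : Type*} [Fintype V] [DecidableEq V]

/-- The simplices of `K`, where the empty simplex always counts as one (of dimension `-1`).
Mathlib's complexes list the nonempty simplices only. -/
def IsFace (K : PreAbstractSimplicialComplex V) (F : Finset V) : Prop := F = ∅ ∨ F ∈ K

theorem IsFace.mono {K : PreAbstractSimplicialComplex V} {F G : Finset V} (hG : IsFace K G)
    (h : F ⊆ G) : IsFace K F := by
  rcases F.eq_empty_or_nonempty with h0 | h0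
  · exact Or.inl h0
  · rcases hG with rfl | hG
    · exact Or.inl (Finset.subset_empty.1 h)
    · exact Or.inr ((K.isRelLowerSet_faces hG).2 h h0)

/-- The faces of `K` with `n` vertices, that is, the `(n - 1)`-dimensional faces
`S_{n-1}(K)`. -/
def Face (K : PreAbstractSimplicialComplex V) (n : ℕ) : Type _ :=
  {F : Finset V // IsFace K F ∧ F.card = n}

instance (K : PreAbstractSimplicialComplex V) (n : ℕ) : Fintype (Face K n) := by
  classical exact inferInstanceAs (Fintype {F : Finset V // IsFace K F ∧ F.card = n})

instance (K : PreAbstractSimplicialComplex V) (n : ℕ) : DecidableEq (Face K n) :=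
  inferInstanceAs (DecidableEq {F : Finset V // IsFace K F ∧ F.card = n})

/-- The ordered `(n - 1)`-simplices `[v_0, …, v_{n-1}]` of `K`. -/
def OrdSimplex (K : PreAbstractSimplicialComplex V) (n : ℕ) : Type _ :=
  {v : Fin n → V // Function.Injective v ∧ IsFace K (univ.image v)}

instance (K : PreAbstractSimplicialComplex V) (n : ℕ) : Fintype (OrdSimplex K n) := by
  classical exact inferInstanceAs
    (Fintype {v : Fin n → V // Function.Injective v ∧ IsFace K (univ.image v)})

instance (K : PreAbstractSimplicialComplex V) (n : ℕ) : DecidableEq (OrdSimplex K n) :=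
  inferInstanceAs
    (DecidableEq {v : Fin n → V // Function.Injective v ∧ IsFace K (univ.image v)})

variable {K : PreAbstractSimplicialComplex V} {n : ℕ}

/-- The underlying face of an ordered simplex. -/
def OrdSimplex.face (v : OrdSimplex K n) : Face K n :=
  ⟨univ.image v.1, v.2.2, by rw [card_image_of_injective _ v.2.1, card_univ, Fintype.card_fin]⟩

/-- Reordering the vertices of an ordered simplex. -/
def OrdSimplex.reorder (v : OrdSimplex K n) (σ : Equiv.Perm (Fin n)) : OrdSimplex K n :=
  ⟨v.1 ∘ σ, v.2.1.comp σ.injective, v.2.2.mono (by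
    intro x hx
    obtain ⟨a, -, rfl⟩ := Finset.mem_image.1 hx
    exact Finset.mem_image_of_mem _ (mem_univ _))⟩

/-- The ordered simplex `[v_0, …, v̂_j, …, v_n]`. -/
def OrdSimplex.omit_vertex (v : OrdSimplex K (n + 1)) (j : Fin (n + 1)) : OrdSimplex K n :=
  ⟨v.1 ∘ j.succAbove, v.2.1.comp Fin.succAbove_right_injective, v.2.2.mono (by
    intro x hx
    obtain ⟨a, -, rfl⟩ := Finset.mem_image.1 hx
    exact Finset.mem_image_of_mem _ (mem_univ _))⟩

/-- An ordering of the vertices of a face (some chosen orientation `[F]`). -/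
def Face.oriented (F : Face K n) : OrdSimplex K n :=
  ⟨fun a => ((F.1.equivFinOfCardEq F.2.2).symm a : V),
    fun _ _ h => (F.1.equivFinOfCardEq F.2.2).symm.injective (Subtype.ext h),
    F.2.1.mono (by
      intro x hx
      obtain ⟨a, -, rfl⟩ := Finset.mem_image.1 hx
      exact ((F.1.equivFinOfCardEq F.2.2).symm a).2)⟩

theorem OrdSimplex.face_reorder (v : OrdSimplex K n) (σ : Equiv.Perm (Fin n)) :
    (v.reorder σ).face = v.face := by
  apply Subtype.ext
  ext x
  simp only [OrdSimplex.face, OrdSimplex.reorder, Finset.mem_image, mem_univ, true_and,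
    Function.comp_apply]
  exact ⟨fun ⟨a, h⟩ => ⟨σ a, h⟩, fun ⟨a, h⟩ => ⟨σ.symm a, by simpa using h⟩⟩

theorem Face.face_oriented (F : Face K n) : F.oriented.face = F := by
  apply Subtype.ext
  ext x
  simp only [OrdSimplex.face, Face.oriented, Finset.mem_image, mem_univ, true_and]
  constructor
  · rintro ⟨a, rfl⟩
    exact ((F.1.equivFinOfCardEq F.2.2).symm a).2
  · intro hx
    exact ⟨F.1.equivFinOfCardEq F.2.2 ⟨x, hx⟩, by simp⟩

theorem OrdSimplex.face_omit_subset (v : OrdSimplex K (n + 1)) (j : Fin (n + 1)) :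
    (v.omit_vertex j).face.1 ⊆ v.face.1 := by
  intro x hx
  obtain ⟨a, -, rfl⟩ := Finset.mem_image.1 hx
  exact Finset.mem_image_of_mem _ (mem_univ _)

end Faces

/-! ### Cochains, coboundary, adjoint, Laplacian -/

section Laplacian

variable {V : Type*} [Fintype V] [DecidableEq V]

/-- The cochain group `C^{n-1}(K, 𝕜)`: functions on ordered `(n - 1)`-simplices that change by
the sign of the permutation when the vertices are reordered. -/
def Cochain (𝕜 : Type*) [RCLike 𝕜] (K : PreAbstractSimplicialComplex V) (n : ℕ) :
    Submodule 𝕜 (OrdSimplex K n → 𝕜) where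
  carrier := {f | ∀ v σ, f (v.reorder σ) = ((Equiv.Perm.sign σ : ℤ) : 𝕜) * f v}
  zero_mem' := by intro v σ; simp
  add_mem' := by
    intro f g hf hg v σ
    simp only [Pi.add_apply, hf v σ, hg v σ, mul_add]
  smul_mem' := by
    intro c f hf v σ
    simp only [Pi.smul_apply, smul_eq_mul, hf v σ]
    ring

/-- Weights on the incidences between `(n - 1)`-faces and `n`-faces: nonzero when `F ∈ ∂ F̄` and
zero otherwise. An incidence-weighted complex carries such weights in every dimension; its down
Laplacian on `n`-cochains involves only these ones. -/
structure IncidenceWeight (𝕜 : Type*) [RCLike 𝕜] (K : PreAbstractSimplicialComplex V)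
    (n : ℕ) where
  toFun : Face K n → Face K (n + 1) → 𝕜
  ne_zero : ∀ F G, F.1 ⊆ G.1 → toFun F G ≠ 0
  eq_zero : ∀ F G, ¬ F.1 ⊆ G.1 → toFun F G = 0

/-- All incidences have weight `1`; this gives the ordinary complex. -/
def IncidenceWeight.one (𝕜 : Type*) [RCLike 𝕜] (K : PreAbstractSimplicialComplex V) (n : ℕ) :
    IncidenceWeight 𝕜 K n where
  toFun F G := if F.1 ⊆ G.1 then 1 else 0
  ne_zero F G h := by simp [h]
  eq_zero F G h := by simp [h]

variable {𝕜 : Type*} [RCLike 𝕜] {K : PreAbstractSimplicialComplex V} {n : ℕ}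

/-- The extension of a permutation of `{0, …, n-1}` to `{0, …, n}` that fixes `0` and acts on
the successors. -/
def extendPerm (τ : Equiv.Perm (Fin n)) : Equiv.Perm (Fin (n + 1)) :=
  Equiv.Perm.decomposeFin.symm (0, τ)

theorem extendPerm_zero (τ : Equiv.Perm (Fin n)) : extendPerm τ 0 = 0 := by
  simp [extendPerm]

theorem extendPerm_succ (τ : Equiv.Perm (Fin n)) (a : Fin n) :
    extendPerm τ a.succ = (τ a).succ := by
  simp [extendPerm]

theorem sign_extendPerm (τ : Equiv.Perm (Fin n)) :
    Equiv.Perm.sign (extendPerm τ) = Equiv.Perm.sign τ := by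
  simp [extendPerm, Equiv.Perm.decomposeFin.symm_sign]

theorem omit_reorder_extendPerm (v : OrdSimplex K (n + 1)) (τ : Equiv.Perm (Fin n)) :
    (v.reorder (extendPerm τ)).omit_vertex 0 = (v.omit_vertex 0).reorder τ := by
  apply Subtype.ext
  funext a
  simp [OrdSimplex.reorder, OrdSimplex.omit_vertex, extendPerm_succ]

/-- Omitting a vertex after a reordering, up to a reordering of known sign. -/
theorem exists_omit_reorder (σ : Equiv.Perm (Fin (n + 1))) (j : Fin (n + 1)) :
    ∃ τ : Equiv.Perm (Fin n),
      (∀ v : OrdSimplex K (n + 1),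
        (v.reorder σ).omit_vertex j = (v.omit_vertex (σ j)).reorder τ) ∧
      ((-1 : ℤ) ^ (j : ℕ)) * (Equiv.Perm.sign τ : ℤ) =
        (Equiv.Perm.sign σ : ℤ) * (-1 : ℤ) ^ (σ j : ℕ) := by
  have h0 : ((σ j).cycleRange * σ * j.cycleRange.symm : Equiv.Perm (Fin (n + 1))) 0 = 0 := by
    simp [Equiv.Perm.mul_apply, Fin.cycleRange_symm_zero]
  obtain ⟨⟨p, τ⟩, hτ⟩ := Equiv.Perm.decomposeFin.symm.surjective
    ((σ j).cycleRange * σ * j.cycleRange.symm : Equiv.Perm (Fin (n + 1)))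
  have hp : p = 0 := by
    rw [← hτ, Equiv.Perm.decomposeFin_symm_apply_zero] at h0
    exact h0
  subst hp
  change extendPerm τ = _ at hτ
  refine ⟨τ, fun v => ?_, ?_⟩
  · apply Subtype.ext
    funext a
    have h1 := congrArg (fun e : Equiv.Perm (Fin (n + 1)) => (σ j).cycleRange.symm (e a.succ)) hτ
    simp only [extendPerm_succ, Equiv.Perm.mul_apply, Fin.cycleRange_symm_succ,
      Equiv.symm_apply_apply] at h1
    simp [OrdSimplex.reorder, OrdSimplex.omit_vertex, h1]
  · have h2 := congrArg (fun e => (Equiv.Perm.sign e : ℤ)) hτ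
    simp only [sign_extendPerm, Equiv.Perm.sign_mul, Equiv.Perm.sign_symm, Fin.sign_cycleRange,
      Units.val_mul, Units.val_pow_eq_pow_val, Units.val_neg, Units.val_one] at h2
    rw [h2]
    have h3 : ((-1 : ℤ) ^ (j : ℕ)) * ((-1 : ℤ) ^ (j : ℕ)) = 1 := by
      rw [← mul_pow]; norm_num
    linear_combination ((-1 : ℤ) ^ (σ j : ℕ)) * (Equiv.Perm.sign σ : ℤ) * h3

/-- The weighted coboundary map `C^{n-1} → C^n`,
`(δ^ω f)[v_0, …, v_n] = ∑_j (-1)^j ω(F_j, F̄) f[v_0, …, v̂_j, …, v_n]`. -/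
def coboundary (ω : IncidenceWeight 𝕜 K n) : Cochain 𝕜 K n →ₗ[𝕜] Cochain 𝕜 K (n + 1) where
  toFun f := ⟨fun v => ∑ j : Fin (n + 1),
      (-1 : 𝕜) ^ (j : ℕ) * ω.toFun (v.omit_vertex j).face v.face * f.1 (v.omit_vertex j), by
    intro v σ
    rw [Finset.mul_sum]
    rw [← Equiv.sum_comp σ (fun j => ((Equiv.Perm.sign σ : ℤ) : 𝕜) * ((-1 : 𝕜) ^ (j : ℕ) *
      ω.toFun (v.omit_vertex j).face v.face * f.1 (v.omit_vertex j)))]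
    refine Finset.sum_congr rfl fun j _ => ?_
    obtain ⟨τ, h1, h2⟩ := exists_omit_reorder (K := K) σ j
    rw [h1 v, f.2 _ τ, OrdSimplex.face_reorder, OrdSimplex.face_reorder]
    have h3 := congrArg (fun z : ℤ => (z : 𝕜)) h2
    push_cast at h3
    linear_combination ω.toFun (v.omit_vertex (σ j)).face v.face *
      f.1 (v.omit_vertex (σ j)) * h3⟩
  map_add' f g := by
    apply Subtype.ext
    funext v
    simp [mul_add, Finset.sum_add_distrib]
  map_smul' c f := by
    apply Subtype.ext
    funext v
    simp only [Submodule.coe_smul, Pi.smul_apply, smul_eq_mul, RingHom.id_apply, Finset.mul_sum]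
    exact Finset.sum_congr rfl fun j _ => by ring

/-- The inner product `⟨f, g⟩ = ∑_F w(F) f([F]) conj(g([F]))` on cochains. -/
def cochainInner (w : Finset V → ℝ) (f g : Cochain 𝕜 K n) : 𝕜 :=
  ∑ F : Face K n, (w F.1 : 𝕜) * f.1 F.oriented * (starRingEnd 𝕜) (g.1 F.oriented)

/-- The map `C^n → C^{n-1}` adjoint to `coboundary ω` for the inner products `cochainInner w`
(see `coboundary_adjoint`). The sum is over the ordered simplices `[u, v_0, …, v_{n-1}]`. -/
def adjointCoboundary (w : Finset V → ℝ) (ω : IncidenceWeight 𝕜 K n) :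
    Cochain 𝕜 K (n + 1) →ₗ[𝕜] Cochain 𝕜 K n where
  toFun g := ⟨fun v => ∑ x : OrdSimplex K (n + 1) with x.omit_vertex 0 = v,
      ((w x.face.1 / w v.face.1 : ℝ) : 𝕜) * (starRingEnd 𝕜) (ω.toFun v.face x.face) * g.1 x, by
    intro v σ
    rw [Finset.mul_sum]
    symm
    refine Finset.sum_bij' (fun x _ => x.reorder (extendPerm σ))
      (fun x _ => x.reorder (extendPerm σ⁻¹)) ?_ ?_ ?_ ?_ ?_
    · intro x hx
      simp only [Finset.mem_filter, mem_univ, true_and] at hx ⊢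
      rw [omit_reorder_extendPerm, hx]
    · intro x hx
      simp only [Finset.mem_filter, mem_univ, true_and] at hx ⊢
      rw [omit_reorder_extendPerm, hx]
      apply Subtype.ext
      funext a
      simp [OrdSimplex.reorder]
    · intro x _
      apply Subtype.ext
      funext a
      refine Fin.cases ?_ (fun b => ?_) a <;>
        simp [OrdSimplex.reorder, extendPerm_zero, extendPerm_succ]
    · intro x _
      apply Subtype.ext
      funext a
      refine Fin.cases ?_ (fun b => ?_) a <;>
        simp [OrdSimplex.reorder, extendPerm_zero, extendPerm_succ]
    · intro x _
      rw [g.2 x (extendPerm σ), OrdSimplex.face_reorder, OrdSimplex.face_reorder,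
        sign_extendPerm]
      ring⟩
  map_add' f g := by
    apply Subtype.ext
    funext v
    simp [mul_add, Finset.sum_add_distrib]
  map_smul' c f := by
    apply Subtype.ext
    funext v
    simp only [Submodule.coe_smul, Pi.smul_apply, smul_eq_mul, RingHom.id_apply, Finset.mul_sum]
    exact Finset.sum_congr rfl fun j _ => by ring

/-- Any two orderings of a face differ by a unique reordering. -/
theorem exists_reorder (v x : OrdSimplex K n) (h : x.face = v.face) :
    ∃ σ : Equiv.Perm (Fin n), v.reorder σ = x := by
  have hmem : ∀ a, ∃ b, v.1 b = x.1 a := by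
    intro a
    have : x.1 a ∈ v.face.1 := by
      rw [← h]; exact Finset.mem_image_of_mem _ (mem_univ _)
    obtain ⟨b, -, hb⟩ := Finset.mem_image.1 this
    exact ⟨b, hb⟩
  choose s hs using hmem
  have hinj : Function.Injective s := fun a b hab => x.2.1 (by rw [← hs a, ← hs b, hab])
  refine ⟨Equiv.ofBijective s (Finite.injective_iff_bijective.1 hinj), ?_⟩
  apply Subtype.ext
  funext a
  exact hs a

/-- A sum over ordered simplices of a quantity that does not see the ordering. -/
theorem sum_ordSimplex (h : OrdSimplex K n → 𝕜) (hh : ∀ v σ, h (v.reorder σ) = h v) :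
    ∑ v, h v = (Nat.factorial n : 𝕜) * ∑ F : Face K n, h F.oriented := by
  rw [Finset.mul_sum, ← Finset.sum_fiberwise (s := univ) (g := fun v : OrdSimplex K n => v.face)]
  refine Finset.sum_congr rfl fun F _ => ?_
  have : ∑ v : OrdSimplex K n with v.face = F, h v =
      ∑ _σ : Equiv.Perm (Fin n), h F.oriented := by
    symm
    refine Finset.sum_bij (fun σ _ => F.oriented.reorder σ) ?_ ?_ ?_ ?_
    · intro σ _
      simp [OrdSimplex.face_reorder, Face.face_oriented]
    · intro σ _ τ _ he
      ext a
      have := congrFun (congrArg Subtype.val he) a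
      exact congrArg _ (F.oriented.2.1 this)
    · intro x hx
      simp only [Finset.mem_filter, mem_univ, true_and] at hx
      obtain ⟨σ, hσ⟩ := exists_reorder F.oriented x (by rw [hx, Face.face_oriented])
      exact ⟨σ, mem_univ _, hσ⟩
    · intro σ _
      exact (hh _ _).symm
  rw [this, Finset.sum_const, card_univ, Fintype.card_perm, Fintype.card_fin, nsmul_eq_mul]

theorem sign_mul_self (σ : Equiv.Perm (Fin n)) :
    ((Equiv.Perm.sign σ : ℤ) : 𝕜) * ((Equiv.Perm.sign σ : ℤ) : 𝕜) = 1 := by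
  rcases Int.units_eq_one_or (Equiv.Perm.sign σ) with h | h <;> simp [h]

theorem factorial_mul_cochainInner (w : Finset V → ℝ) (f g : Cochain 𝕜 K n) :
    (Nat.factorial n : 𝕜) * cochainInner w f g =
      ∑ v : OrdSimplex K n, (w v.face.1 : 𝕜) * f.1 v * (starRingEnd 𝕜) (g.1 v) := by
  rw [sum_ordSimplex]
  · simp only [cochainInner, Face.face_oriented]
  · intro v σ
    rw [OrdSimplex.face_reorder, f.2 v σ, g.2 v σ, map_mul, map_intCast]
    linear_combination (w v.face.1 : 𝕜) * f.1 v * (starRingEnd 𝕜) (g.1 v) *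
      sign_mul_self (𝕜 := 𝕜) σ

/-- `adjointCoboundary w ω` is the adjoint of `coboundary ω`. -/
theorem coboundary_adjoint (w : Finset V → ℝ) (hw : ∀ F, IsFace K F → 0 < w F)
    (ω : IncidenceWeight 𝕜 K n) (f : Cochain 𝕜 K n) (g : Cochain 𝕜 K (n + 1)) :
    cochainInner w (coboundary ω f) g = cochainInner w f (adjointCoboundary w ω g) := by
  set S : 𝕜 := ∑ x : OrdSimplex K (n + 1), (w x.face.1 : 𝕜) *
    ω.toFun (x.omit_vertex 0).face x.face * f.1 (x.omit_vertex 0) * (starRingEnd 𝕜) (g.1 x)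
    with hS
  have h1 : (Nat.factorial (n + 1) : 𝕜) * cochainInner w (coboundary ω f) g = (n + 1 : 𝕜) * S := by
    rw [factorial_mul_cochainInner]
    simp only [coboundary, LinearMap.coe_mk, AddHom.coe_mk, Finset.mul_sum, Finset.sum_mul]
    rw [Finset.sum_comm]
    have : ∀ j : Fin (n + 1), ∑ x : OrdSimplex K (n + 1), (w x.face.1 : 𝕜) * ((-1) ^ (j : ℕ) *
        ω.toFun (x.omit_vertex j).face x.face * f.1 (x.omit_vertex j)) *
          (starRingEnd 𝕜) (g.1 x) = S := by
      intro j
      symm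
      refine Finset.sum_bij' (fun x _ => x.reorder j.cycleRange)
        (fun x _ => x.reorder j.cycleRange.symm) ?_ ?_ ?_ ?_ ?_
      · simp
      · simp
      · intro x _
        apply Subtype.ext; funext a; simp [OrdSimplex.reorder]
      · intro x _
        apply Subtype.ext; funext a; simp [OrdSimplex.reorder]
      · intro x _
        have h0 : (x.reorder j.cycleRange).omit_vertex j = x.omit_vertex 0 := by
          apply Subtype.ext
          funext a
          simp [OrdSimplex.reorder, OrdSimplex.omit_vertex]
        rw [h0, OrdSimplex.face_reorder, g.2 x, Fin.sign_cycleRange, map_mul, map_intCast]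
        have h3 : ((-1 : 𝕜) ^ (j : ℕ)) * ((-1 : 𝕜) ^ (j : ℕ)) = 1 := by
          rw [← mul_pow]; norm_num
        push_cast
        linear_combination -(w x.face.1 : 𝕜) * ω.toFun (x.omit_vertex 0).face x.face *
          f.1 (x.omit_vertex 0) * (starRingEnd 𝕜) (g.1 x) * h3
    rw [Finset.sum_congr rfl fun j _ => this j]
    simp
  have h2 : (Nat.factorial n : 𝕜) * cochainInner w f (adjointCoboundary w ω g) = S := by
    rw [factorial_mul_cochainInner, hS,
      ← Finset.sum_fiberwise (s := univ) (g := fun x : OrdSimplex K (n + 1) => x.omit_vertex 0)]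
    refine Finset.sum_congr rfl fun v _ => ?_
    simp only [adjointCoboundary, LinearMap.coe_mk, AddHom.coe_mk, map_sum, Finset.mul_sum]
    refine Finset.sum_congr rfl fun x hx => ?_
    simp only [Finset.mem_filter, mem_univ, true_and] at hx
    subst hx
    have hne : (w (x.omit_vertex 0).face.1 : 𝕜) ≠ 0 := by
      exact_mod_cast (hw _ (x.omit_vertex 0).face.2.1).ne'
    simp only [map_mul, RCLike.conj_ofReal, RCLike.conj_conj]
    push_cast
    field_simp
  have hn : (Nat.factorial n : 𝕜) ≠ 0 := by exact_mod_cast Nat.factorial_ne_zero n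
  have hn1 : (n + 1 : 𝕜) ≠ 0 := by exact_mod_cast Nat.succ_ne_zero n
  rw [← h2, Nat.factorial_succ] at h1
  push_cast at h1
  rw [mul_assoc] at h1
  exact mul_left_cancel₀ hn (mul_left_cancel₀ hn1 h1)

variable (K) in
/-- The `i`-down Laplace operator `δ_{i-1}^ω (δ_{i-1}^ω)^*` of the incidence-weighted complex
`(K, ω)` with face weights `w`, acting on `C^i(K, 𝕜)`. -/
def weightedDownLaplacian (i : ℕ) (w : Finset V → ℝ) (ω : IncidenceWeight 𝕜 K i) :
    Module.End 𝕜 (Cochain 𝕜 K (i + 1)) :=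
  coboundary ω ∘ₗ adjointCoboundary w ω

/-- The `i`-down Laplace operator `δ_{i-1} δ_{i-1}^*` of `K` with face weights `w`, acting on
`C^i(K, ℝ)`. -/
def downLaplacian (K : PreAbstractSimplicialComplex V) (i : ℕ) (w : Finset V → ℝ) :
    Module.End ℝ (Cochain ℝ K (i + 1)) :=
  weightedDownLaplacian K i w (IncidenceWeight.one ℝ K i)

/-- The spectrum of an operator as a multiset: the complex roots of its characteristic
polynomial with their multiplicities. -/
def spec [Algebra 𝕜 ℂ] {E : Type*} [AddCommGroup E] [Module 𝕜 E] [Module.Finite 𝕜 E]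
    [Module.Free 𝕜 E] (A : Module.End 𝕜 E) : Multiset ℂ :=
  (LinearMap.charpoly A).aroots ℂ

end Laplacian

/-! ### Coverings -/

section Covering

variable {V W : Type*} [Fintype V] [DecidableEq V] [Fintype W] [DecidableEq W]

/-- The graph on the vertices of `K` formed by the edges (the `1`-skeleton). -/
def skeletonGraph (K : PreAbstractSimplicialComplex V) : SimpleGraph {v : V // {v} ∈ K} where
  Adj u v := u ≠ v ∧ ({u.1, v.1} : Finset V) ∈ K
  symm := ⟨fun u v h => ⟨h.1.symm, by rw [Finset.pair_comm]; exact h.2⟩⟩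
  loopless := ⟨fun _ h => h.1 rfl⟩

/-- `φ : K → M` is a (strong) covering. Only the values of `φ` at vertices of `K` matter. -/
structure IsCovering (K : PreAbstractSimplicialComplex V) (M : PreAbstractSimplicialComplex W)
    (φ : V → W) : Prop where
  connected : (skeletonGraph K).Connected
  simplicial : ∀ F, IsFace K F → IsFace M (F.image φ)
  /-- Every simplex of `K` over a simplex `G` of `M` is mapped bijectively onto `G`. -/
  bijOn : ∀ G, IsFace M G → ∀ F, IsFace K F → F.image φ = G → Set.BijOn φ F G
  /-- Distinct simplices of `K` over the same simplex of `M` are disjoint. -/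
  disjoint : ∀ G, IsFace M G → ∀ F F', IsFace K F → IsFace K F' → F.image φ = G →
    F'.image φ = G → F ≠ F' → Disjoint F F'
  /-- The simplices of `K` over `G` exhaust the vertices of `K` over `G`. -/
  exhaust : ∀ G, IsFace M G → ∀ v, {v} ∈ K → φ v ∈ G → ∃ F, IsFace K F ∧ F.image φ = G ∧ v ∈ F
  /-- Strongness: a simplex `F` over a facet `G` of `G'` extends to a simplex over `G'`. -/
  lift : ∀ G G', IsFace M G → IsFace M G' → G ⊆ G' → G'.card = G.card + 1 →
    ∀ F, IsFace K F → F.image φ = G →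
      ∃ F', IsFace K F' ∧ F ⊆ F' ∧ F'.card = F.card + 1 ∧ F'.image φ = G'

/-- `φ : K → M` is a `k`-fold covering: over every nonempty simplex of `M` there are exactly `k`
simplices of `K`. -/
structure IsFoldCovering (k : ℕ) (K : PreAbstractSimplicialComplex V)
    (M : PreAbstractSimplicialComplex W) (φ : V → W) : Prop extends IsCovering K M φ where
  degree : ∀ G ∈ M, Set.ncard {F : Finset V | F ∈ K ∧ F.image φ = G} = k

end Covering

/-! ### Incidence graphs, voltages and derived graphs -/

section Voltage

variable {V : Type*} [Fintype V] [DecidableEq V]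

/-- The incidence graph `B_{n-1}(K)` on `S_{n-1}(K) ∪ S_n(K)`, with an edge `{F, F̄}` whenever
`F ∈ ∂ F̄`. -/
def incidenceGraph (K : PreAbstractSimplicialComplex V) (n : ℕ) :
    SimpleGraph (Face K n ⊕ Face K (n + 1)) where
  Adj
    | .inl F, .inr G => F.1 ⊆ G.1
    | .inr G, .inl F => F.1 ⊆ G.1
    | _, _ => False
  symm := ⟨by rintro (F | F) (G | G) h <;> exact h⟩
  loopless := ⟨by rintro (F | F) h <;> exact h⟩

/-- The simplex that a vertex of the incidence graph stands for. -/
def simplexOf {K : PreAbstractSimplicialComplex V} {n : ℕ} :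
    Face K n ⊕ Face K (n + 1) → Finset V
  | .inl F => F.1
  | .inr F => F.1

/-- A permutation voltage assignment on the arcs of a simple graph, with
`ψ(e⁻¹) = ψ(e)⁻¹`. -/
structure Voltage {X : Type*} (B : SimpleGraph X) (k : ℕ) where
  toFun : B.Dart → Equiv.Perm (Fin k)
  map_symm : ∀ d, toFun d.symm = (toFun d)⁻¹

/-- The derived graph `B^ψ` on `V(B) × [k]`: `(u, a)` and `(v, b)` are adjacent if `{u, v}` is an
edge of `B` and `a = ψ(u, v)(b)`. -/
def derivedGraph {X : Type*} {B : SimpleGraph X} {k : ℕ} (ψ : Voltage B k) :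
    SimpleGraph (X × Fin k) where
  Adj x y := ∃ h : B.Adj x.1 y.1, x.2 = ψ.toFun ⟨(x.1, y.1), h⟩ y.2
  symm := ⟨by
    rintro x y ⟨h, hxy⟩
    refine ⟨h.symm, ?_⟩
    have := ψ.map_symm ⟨(x.1, y.1), h⟩
    change ψ.toFun ⟨(y.1, x.1), h.symm⟩ = _ at this
    rw [this, hxy]
    exact (Equiv.symm_apply_apply _ _).symm⟩
  loopless := ⟨fun x h => B.loopless.irrefl x.1 h.1⟩

variable {M : PreAbstractSimplicialComplex V} {n k : ℕ}

/-- The permutation `ψ(F, F̄)` of an incidence `F ∈ ∂ F̄`. -/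
def Voltage.incidence (ψ : Voltage (incidenceGraph M n) k) (F : Face M n) (G : Face M (n + 1))
    (h : F.1 ⊆ G.1) : Equiv.Perm (Fin k) :=
  ψ.toFun ⟨(.inl F, .inr G), h⟩

/-- The voltage group `Ψ_{n-1}`, generated by the permutations `ψ(F, F̄)`. -/
def Voltage.group (ψ : Voltage (incidenceGraph M n) k) : Subgroup (Equiv.Perm (Fin k)) :=
  Subgroup.closure {g | ∃ F G, ∃ h : F.1 ⊆ G.1, g = ψ.incidence F G h}

/-- The incidence weights `ω(F, F̄) = χ(ψ(F, F̄))` for a degree-one representation `χ` of the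
voltage group. -/
def Voltage.weight (ψ : Voltage (incidenceGraph M n) k) (χ : ψ.group →* ℂˣ) :
    IncidenceWeight ℂ M n where
  toFun F G := if h : F.1 ⊆ G.1 then
    (χ ⟨ψ.incidence F G h, Subgroup.subset_closure ⟨F, G, h, rfl⟩⟩ : ℂ) else 0
  ne_zero F G h := by simp [h]
  eq_zero F G h := by simp [h]

/-- The matrix `P^g`, with `(a, b)` entry `1` if `a = g b` and `0` otherwise. -/
def permMat {k : ℕ} (g : Equiv.Perm (Fin k)) : Matrix (Fin k) (Fin k) ℂ :=
  Matrix.of fun a b => if a = g b then 1 else 0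

/-- The permutation representation `g ↦ P^g` of `H` decomposes as the direct sum of the degree-one
representations `ϱ 0, …, ϱ (k-1)`, the first of which is trivial. -/
def IsDecomposition {k : ℕ} [NeZero k] (H : Subgroup (Equiv.Perm (Fin k)))
    (ϱ : Fin k → (H →* ℂˣ)) : Prop :=
  ϱ 0 = 1 ∧ ∃ T : Matrix (Fin k) (Fin k) ℂ, IsUnit T ∧
    ∀ g : H, T⁻¹ * permMat (g : Equiv.Perm (Fin k)) * T =
      Matrix.diagonal fun j => (ϱ j g : ℂ)

end Voltage

end CoverSpec

end

noncomputable section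

set_option linter.unusedSectionVars false

namespace CoverSpec

/-! ### Coordinates on cochains and passage from real to complex coefficients -/

section CochainBasis

variable {𝕜 : Type*} [RCLike 𝕜] {V : Type*} [Fintype V] [DecidableEq V]
variable {K : PreAbstractSimplicialComplex V} {n : ℕ}

/-! The isomorphism `η` presents the simplices of `K` in dimensions `i - 1` and `i` as `k` sheets
over those of `M`, where sheet `b` over `G` is incident with sheet `ψ(F, G) b` over `F`. A cochain
of `K` is thus a `k`-tuple of cochains of `M`, on which the coboundary of `K` acts through the
permutation matrices of the voltages. Diagonalizing these matrices simultaneously decouples the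
tuple.

Concretely, if `T⁻¹ P^g T` is diagonal with entries `ϱ j g`, then `S = (T⁻¹)ᵀ` satisfies `S (g b) j
= ϱ j g * S b j`. `Sheets.combine` sends `(f_j)` to the cochain whose value at `v` is `∑ j, S (sheet
v) j * f_j (φ v)`; it is an isomorphism because `S` is invertible. The rule for `S` turns a change
of sheet along an incidence into the weight `ω_j`, so the map intertwines `⨁ δ^{ω_j}` with `δ`
(`coboundary_combine`). It need not be an isometry, so the adjoints are compared separately
(`adjointCoboundary_combine`): cofaces lift uniquely, and characters of a finite group are unitary.
Hence the down Laplacian of `K` is conjugate to the direct sum of the weighted ones of `M`, and its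
characteristic polynomial is their product (`charpoly_downLaplacian`). The trivial character gives
the factor of `M` itself.

A decomposition exists because averaging against characters writes every vector as a sum of common
eigenvectors, and the all-ones vector is one with trivial character. -/

theorem OrdSimplex.reorder_injective (v : OrdSimplex K n) : Function.Injective v.reorder := by
  intro σ τ h
  ext a
  exact congrArg _ (v.2.1 (congrFun (congrArg Subtype.val h) a))

theorem OrdSimplex.reorder_reorder (v : OrdSimplex K n) (σ τ : Equiv.Perm (Fin n)) :
    (v.reorder σ).reorder τ = v.reorder (σ * τ) := rfl

/-- The permutation that takes the chosen orientation of a face to a given ordering of it. -/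
def OrdSimplex.perm (v : OrdSimplex K n) : Equiv.Perm (Fin n) :=
  (exists_reorder v.face.oriented v (Face.face_oriented _).symm).choose

theorem OrdSimplex.oriented_reorder_perm (v : OrdSimplex K n) :
    v.face.oriented.reorder v.perm = v :=
  (exists_reorder v.face.oriented v (Face.face_oriented _).symm).choose_spec

theorem OrdSimplex.perm_reorder (v : OrdSimplex K n) (σ : Equiv.Perm (Fin n)) :
    (v.reorder σ).perm = v.perm * σ := by
  apply v.face.oriented.reorder_injective
  rw [← OrdSimplex.reorder_reorder, v.oriented_reorder_perm]
  conv_rhs => rw [← (v.reorder σ).oriented_reorder_perm]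
  rw [OrdSimplex.face_reorder]

theorem Face.perm_oriented (F : Face K n) : F.oriented.perm = 1 := by
  apply F.oriented.reorder_injective
  have := F.oriented.oriented_reorder_perm
  rw [Face.face_oriented] at this
  exact this

theorem Cochain.apply_eq (f : Cochain 𝕜 K n) (v : OrdSimplex K n) :
    f.1 v = ((Equiv.Perm.sign v.perm : ℤ) : 𝕜) * f.1 v.face.oriented := by
  conv_lhs => rw [← v.oriented_reorder_perm]
  exact f.2 _ _

variable (𝕜 K n) in
/-- A cochain is determined by its values on the oriented faces, which are arbitrary. -/
def Cochain.equivFun : Cochain 𝕜 K n ≃ₗ[𝕜] (Face K n → 𝕜) where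
  toFun f F := f.1 F.oriented
  map_add' _ _ := rfl
  map_smul' _ _ := rfl
  invFun c := ⟨fun v => ((Equiv.Perm.sign v.perm : ℤ) : 𝕜) * c v.face, by
    intro v σ
    beta_reduce
    rw [OrdSimplex.perm_reorder, OrdSimplex.face_reorder, Equiv.Perm.sign_mul]
    push_cast
    ring⟩
  left_inv f := by
    apply Subtype.ext
    funext v
    exact (Cochain.apply_eq f v).symm
  right_inv c := by
    funext F
    simp [Face.perm_oriented, Face.face_oriented]

variable (𝕜 K n) in
/-- The basis of the cochain group dual to the oriented faces. -/
def Cochain.basis : Module.Basis (Face K n) 𝕜 (Cochain 𝕜 K n) :=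
  Module.Basis.ofEquivFun (Cochain.equivFun 𝕜 K n)

theorem Cochain.basis_repr (f : Cochain 𝕜 K n) (F : Face K n) :
    (Cochain.basis 𝕜 K n).repr f F = f.1 F.oriented := rfl

variable (𝕜 K n) in
theorem Cochain.finrank : Module.finrank 𝕜 (Cochain 𝕜 K n) = Fintype.card (Face K n) :=
  Module.finrank_eq_card_basis (Cochain.basis 𝕜 K n)

/-- A real cochain regarded as a complex one. -/
def complexify (f : Cochain ℝ K n) : Cochain ℂ K n :=
  ⟨fun v => (f.1 v : ℂ), fun v σ => by
    have := f.2 v σ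
    simp only [this]
    push_cast
    rfl⟩

theorem complexify_basis (F : Face K n) :
    complexify (Cochain.basis ℝ K n F) = Cochain.basis ℂ K n F := by
  apply (Cochain.basis ℂ K n).repr.injective
  ext G
  rw [Module.Basis.repr_self, Cochain.basis_repr]
  change (((Cochain.basis ℝ K n F).1 G.oriented : ℝ) : ℂ) = _
  rw [← Cochain.basis_repr, Module.Basis.repr_self]
  by_cases h : F = G <;> simp [h]

theorem IncidenceWeight.one_ofReal (F : Face K n) (G : Face K (n + 1)) :
    (((IncidenceWeight.one ℝ K n).toFun F G : ℝ) : ℂ) = (IncidenceWeight.one ℂ K n).toFun F G := by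
  by_cases h : F.1 ⊆ G.1 <;> simp [IncidenceWeight.one, h]

theorem weightedDownLaplacian_complexify (i : ℕ) (w : Finset V → ℝ)
    (f : Cochain ℝ K (i + 1)) :
    weightedDownLaplacian K i w (IncidenceWeight.one ℂ K i) (complexify f) =
      complexify (downLaplacian K i w f) := by
  apply Subtype.ext
  funext v
  simp [weightedDownLaplacian, downLaplacian, coboundary, adjointCoboundary, complexify,
    ← IncidenceWeight.one_ofReal]

/-- The real down Laplacian has the same spectrum as its complexification. -/
theorem spec_downLaplacian (K : PreAbstractSimplicialComplex V) (i : ℕ) (w : Finset V → ℝ) :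
    spec (downLaplacian K i w) =
      spec (weightedDownLaplacian K i w (IncidenceWeight.one ℂ K i)) := by
  -- Complexification carries the real basis to the complex one and commutes with the operators, so
  -- the two matrices have the same entries.
  have h : LinearMap.toMatrix (Cochain.basis ℂ K (i + 1)) (Cochain.basis ℂ K (i + 1))
      (weightedDownLaplacian K i w (IncidenceWeight.one ℂ K i)) =
      (LinearMap.toMatrix (Cochain.basis ℝ K (i + 1)) (Cochain.basis ℝ K (i + 1))
        (downLaplacian K i w)).map (algebraMap ℝ ℂ) := by
    ext F G
    rw [Matrix.map_apply, LinearMap.toMatrix_apply, LinearMap.toMatrix_apply,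
      ← complexify_basis, weightedDownLaplacian_complexify]
    rfl
  unfold spec
  rw [← LinearMap.charpoly_toMatrix _ (Cochain.basis ℂ K (i + 1)), h,
    ← LinearMap.charpoly_toMatrix _ (Cochain.basis ℝ K (i + 1)), Matrix.charpoly_map]
  simp [Polynomial.aroots]

end CochainBasis

/-! ### Characteristic polynomials of direct sums -/

section Charpoly

theorem charpoly_blockDiagonal {o m : Type*} [Fintype o] [DecidableEq o] [Fintype m]
    [DecidableEq m] {R : Type*} [CommRing R] (A : o → Matrix m m R) :
    (Matrix.blockDiagonal A).charpoly = ∏ j, (A j).charpoly := by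
  unfold Matrix.charpoly
  rw [← Matrix.det_blockDiagonal]
  congr 1
  ext ⟨x, a⟩ ⟨y, b⟩
  by_cases h : a = b <;> by_cases h' : x = y <;>
    simp [Matrix.blockDiagonal_apply, h, h']

/-- The characteristic polynomial of a direct sum of endomorphisms of one space. -/
theorem charpoly_pi {o : Type*} [Fintype o] [DecidableEq o] {R E : Type*} [Field R]
    [AddCommGroup E] [Module R E] [Module.Finite R E] (A : o → Module.End R E) :
    LinearMap.charpoly (LinearMap.pi fun j => A j ∘ₗ LinearMap.proj j :
      Module.End R (o → E)) = ∏ j, (A j).charpoly := by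
  let b := Module.finBasis R E
  -- The factor index comes second in the reindexed basis, as `Matrix.blockDiagonal` expects.
  let c := (Pi.basis fun _ : o => b).reindex ((Equiv.sigmaEquivProd _ _).trans (Equiv.prodComm _ _))
  rw [← LinearMap.charpoly_toMatrix _ c]
  have : LinearMap.toMatrix c c (LinearMap.pi fun j => A j ∘ₗ LinearMap.proj j) =
      Matrix.blockDiagonal fun j => LinearMap.toMatrix b b (A j) := by
    ext ⟨x, a⟩ ⟨y, d⟩
    rw [LinearMap.toMatrix_apply, Module.Basis.repr_reindex_apply, Module.Basis.reindex_apply]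
    by_cases h : a = d
    · subst h
      simp [LinearMap.toMatrix_apply, Matrix.blockDiagonal_apply, Pi.basis_repr, Pi.basis_apply]
    · simp [Matrix.blockDiagonal_apply, Pi.basis_repr, Pi.basis_apply, h]
  rw [this, charpoly_blockDiagonal]
  exact Finset.prod_congr rfl fun j _ => LinearMap.charpoly_toMatrix _ _

end Charpoly

/-! ### Simultaneous diagonalization of an abelian permutation group -/

section Decomposition

variable {k : ℕ}

theorem permMat_apply (g : Equiv.Perm (Fin k)) (a b : Fin k) :
    permMat g a b = if a = g b then 1 else 0 := by
  by_cases h : a = g b <;> simp [permMat, h]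

theorem permMat_mul (g h : Equiv.Perm (Fin k)) : permMat (g * h) = permMat g * permMat h := by
  ext a b
  by_cases hab : a = g (h b) <;> simp [permMat_apply, Matrix.mul_apply, hab]

theorem permMat_one : permMat (1 : Equiv.Perm (Fin k)) = 1 := by
  ext a b
  by_cases hab : a = b <;> simp [permMat_apply, Matrix.one_apply, hab]

/-- The common eigenvectors of an abelian permutation group span the permutation module. -/
theorem span_common_eigenvectors (H : Subgroup (Equiv.Perm (Fin k)))
    (hab : ∀ a ∈ H, ∀ b ∈ H, a * b = b * a) :
    Submodule.span ℂ {v : Fin k → ℂ | ∃ χ : H →* ℂˣ, ∀ g : H,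
      (permMat (g : Equiv.Perm (Fin k))).mulVec v = (χ g : ℂ) • v} = ⊤ := by
  classical
  let : CommGroup H :=
    { (inferInstance : Group H) with
      mul_comm := fun a b => Subtype.ext (hab a a.2 b b.2) }
  rw [eq_top_iff]
  rintro v -
  have hcard : (Fintype.card (Additive H) : ℂ) ≠ 0 := by
    exact_mod_cast Fintype.card_ne_zero
  -- The inner sum is an unnormalized projection of `v` to an isotypic component. Summed over all
  -- characters, orthogonality kills every `h` except `1`, which leaves `|H| • v`.
  have key : (Fintype.card (Additive H) : ℂ) • v = ∑ χ : AddChar (Additive H) ℂ,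
      ∑ h : H, χ (Additive.ofMul h) • (permMat (h : Equiv.Perm (Fin k))).mulVec v := by
    rw [Finset.sum_comm]
    simp_rw [← Finset.sum_smul, AddChar.sum_apply_eq_ite, ite_smul, zero_smul]
    rw [Finset.sum_eq_single (1 : H)]
    · simp [permMat_one]
    · intro b _ hb
      rw [if_neg]
      simpa using hb
    · simp
  have hv : v = (Fintype.card (Additive H) : ℂ)⁻¹ • (Fintype.card (Additive H) : ℂ) • v := by
    rw [smul_smul, inv_mul_cancel₀ hcard, one_smul]
  rw [hv, key]
  refine Submodule.smul_mem _ _ (Submodule.sum_mem _ fun χ _ => Submodule.subset_span ?_)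
  -- Averaging with the coefficients `χ h` gives an eigenvector for the inverse character, hence
  -- `h⁻¹` here.
  let f : H →* ℂ :=
    { toFun := fun h => χ (Additive.ofMul h⁻¹)
      map_one' := by simp
      map_mul' := fun a b => by
        rw [mul_inv, ofMul_mul, AddChar.map_add_eq_mul] }
  refine ⟨f.toHomUnits, fun g => ?_⟩
  rw [Matrix.mulVec_sum, MonoidHom.coe_toHomUnits, Finset.smul_sum,
    ← Equiv.sum_comp (Equiv.mulLeft g) fun h : H =>
      f g • χ (Additive.ofMul h) • (permMat (h : Equiv.Perm (Fin k))).mulVec v]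
  refine Finset.sum_congr rfl fun h _ => ?_
  rw [Matrix.mulVec_smul, Matrix.mulVec_mulVec, ← permMat_mul, smul_smul]
  congr 1
  change _ = χ (Additive.ofMul g⁻¹) * χ (Additive.ofMul (g * h))
  rw [← AddChar.map_add_eq_mul, ← ofMul_mul, inv_mul_cancel_left]

/-- The permutation representation of an abelian group splits into characters, the first of which
can be taken trivial. -/
theorem exists_isDecomposition [NeZero k] (H : Subgroup (Equiv.Perm (Fin k)))
    (hab : ∀ a ∈ H, ∀ b ∈ H, a * b = b * a) : ∃ ϱ : Fin k → (H →* ℂˣ), IsDecomposition H ϱ := by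
  classical
  set t := {v : Fin k → ℂ | ∃ χ : H →* ℂˣ, ∀ g : H,
      (permMat (g : Equiv.Perm (Fin k))).mulVec v = (χ g : ℂ) • v}
  have hone : ∀ g : Equiv.Perm (Fin k), (permMat g).mulVec (1 : Fin k → ℂ) = 1 := by
    intro g
    ext a
    simp only [Matrix.mulVec, dotProduct, permMat_apply, Pi.one_apply, mul_one]
    rw [Finset.sum_eq_single (g.symm a)]
    · simp
    · intro b _ hb
      rw [if_neg]
      rintro rfl
      simp at hb
    · simp
  -- The all-ones vector is fixed by every permutation matrix; it is extended to a basis chosen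
  -- among the common eigenvectors.
  obtain ⟨b, hbt, hsb, htb, hli⟩ := exists_linearIndepOn_id_extension
    (K := ℂ)
    (s := {(1 : Fin k → ℂ)}) (t := t) (LinearIndepOn.singleton one_ne_zero) (by
      rw [Set.singleton_subset_iff]
      exact ⟨1, fun g => by simp [hone]⟩)
  have hspan : ⊤ ≤ Submodule.span ℂ (Set.range ((↑) : b → (Fin k → ℂ))) := by
    rw [Subtype.range_coe, ← span_common_eigenvectors H hab]
    exact Submodule.span_le.2 htb
  let B := Module.Basis.mk hli hspan
  have : Finite b := Module.Finite.finite_basis B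
  have : Fintype b := Fintype.ofFinite b
  have hcard : Fintype.card b = Fintype.card (Fin k) := by
    rw [← Module.finrank_eq_card_basis B, Module.finrank_pi]
  let o : b := ⟨1, hsb rfl⟩
  let e₀ := Fintype.equivOfCardEq hcard
  -- The swap moves the all-ones vector to index `0`, where the trivial character is required.
  let e := e₀.trans (Equiv.swap (e₀ o) 0)
  have heo : e o = 0 := by simp [e]
  choose χ hχ using fun x : b => hbt x.2
  let B' := B.reindex e
  have hB' : ∀ j, B' j = (e.symm j : b).1 := fun j => by simp [B', B]
  let T : Matrix (Fin k) (Fin k) ℂ := Matrix.of fun a j => B' j a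
  have hTB : T = (Pi.basisFun ℂ (Fin k)).toMatrix B' := by
    ext a j
    simp [T, Module.Basis.toMatrix_apply]
  have hT : IsUnit T := by
    rw [hTB]
    let := (Pi.basisFun ℂ (Fin k)).invertibleToMatrix B'
    exact isUnit_of_invertible _
  refine ⟨fun j => χ (e.symm j), ?_, T, hT, fun g => ?_⟩
  · have h0 : e.symm 0 = o := by rw [← heo, Equiv.symm_apply_apply]
    ext g
    have := congrFun (hχ o g) 0
    beta_reduce
    rw [h0]
    simpa [o, hone] using this.symm
  · have hPT : permMat (g : Equiv.Perm (Fin k)) * T =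
        T * Matrix.diagonal fun j => (χ (e.symm j) g : ℂ) := by
      ext a j
      have := congrFun (hχ (e.symm j) g) a
      rw [Matrix.mul_diagonal]
      simp only [T, Matrix.mul_apply, Matrix.of_apply, hB']
      rw [mul_comm]
      exact this
    rw [mul_assoc, hPT, ← mul_assoc,
      Matrix.nonsing_inv_mul _ ((Matrix.isUnit_iff_isUnit_det _).1 hT), one_mul]

end Decomposition

/-! ### Sheets and the lifting of cochains -/

section Lift

variable {V W : Type*} [Fintype V] [DecidableEq V] [Fintype W] [DecidableEq W]
variable {K : PreAbstractSimplicialComplex V} {M : PreAbstractSimplicialComplex W} {φ : V → W}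

/-- `φ` maps simplices to simplices of the same dimension. -/
structure IsNondegenerate (K : PreAbstractSimplicialComplex V) (M : PreAbstractSimplicialComplex W)
    (φ : V → W) : Prop where
  simplicial : ∀ F, IsFace K F → IsFace M (F.image φ)
  injOn : ∀ F, IsFace K F → Set.InjOn φ F

theorem IsCovering.isNondegenerate (h : IsCovering K M φ) : IsNondegenerate K M φ where
  simplicial := h.simplicial
  injOn F hF := (h.bijOn _ (h.simplicial F hF) F hF rfl).injOn

theorem OrdSimplex.mem_face {n : ℕ} (v : OrdSimplex K n) (t : Fin n) : v.1 t ∈ v.face.1 :=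
  Finset.mem_image_of_mem _ (mem_univ _)

/-- The image of an ordered simplex under a nondegenerate simplicial map. -/
def OrdSimplex.push {n : ℕ} (hφ : IsNondegenerate K M φ) (v : OrdSimplex K n) : OrdSimplex M n :=
  ⟨φ ∘ v.1, fun _ _ h => v.2.1 (hφ.injOn _ v.2.2 (v.mem_face _) (v.mem_face _) h), by
    rw [← Finset.image_image]
    exact hφ.simplicial _ v.2.2⟩

variable (hφ : IsNondegenerate K M φ)

theorem OrdSimplex.push_face {n : ℕ} (v : OrdSimplex K n) :
    (v.push hφ).face.1 = v.face.1.image φ := by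
  simp only [OrdSimplex.face, OrdSimplex.push, Finset.image_image]

theorem OrdSimplex.push_reorder {n : ℕ} (v : OrdSimplex K n) (σ : Equiv.Perm (Fin n)) :
    (v.reorder σ).push hφ = (v.push hφ).reorder σ := rfl

theorem OrdSimplex.push_omit {n : ℕ} (v : OrdSimplex K (n + 1)) (j : Fin (n + 1)) :
    (v.omit_vertex j).push hφ = (v.push hφ).omit_vertex j := rfl

/-- Lifts inside one common simplex `F` are unique because `φ` is injective on `F`. This identifies
a facet of a lifted simplex with a prescribed lift. -/
theorem OrdSimplex.push_inj {n : ℕ} {v x : OrdSimplex K n} {F : Finset V} (hF : IsFace K F)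
    (hv : v.face.1 ⊆ F) (hx : x.face.1 ⊆ F) (h : v.push hφ = x.push hφ) : v = x := by
  apply Subtype.ext
  funext t
  exact hφ.injOn F hF (hv (v.mem_face t)) (hx (x.mem_face t))
    (congrFun (congrArg Subtype.val h) t)

variable {n k : ℕ}

/-- An enumeration of the `n`-vertex faces of `K` as `k` copies of those of `M`. -/
structure Sheets (K : PreAbstractSimplicialComplex V) (M : PreAbstractSimplicialComplex W)
    (φ : V → W) (n k : ℕ) where
  equiv : Face M n × Fin k ≃ Face K n
  image_equiv : ∀ x, (equiv x).1.image φ = x.1.1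

variable (e : Sheets K M φ n k)

/-- The sheet that an ordered simplex lies in. -/
def Sheets.sheet (v : OrdSimplex K n) : Fin k := (e.equiv.symm v.face).2

theorem Sheets.face_eq (v : OrdSimplex K n) : v.face = e.equiv ((v.push hφ).face, e.sheet v) := by
  have h : (v.push hφ).face = (e.equiv.symm v.face).1 := by
    apply Subtype.ext
    rw [OrdSimplex.push_face, ← e.image_equiv, Equiv.apply_symm_apply]
  rw [h]
  exact (e.equiv.apply_symm_apply _).symm

theorem Sheets.sheet_reorder (v : OrdSimplex K n) (σ : Equiv.Perm (Fin n)) :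
    e.sheet (v.reorder σ) = e.sheet v := by
  unfold Sheets.sheet
  rw [OrdSimplex.face_reorder]

/-- Every ordered simplex of `M` lifts to each sheet. -/
theorem Sheets.exists_lift (u : OrdSimplex M n) (a : Fin k) :
    ∃ v : OrdSimplex K n, v.push hφ = u ∧ e.sheet v = a := by
  have hmem : ∀ t, ∃ x ∈ (e.equiv (u.face, a)).1, φ x = u.1 t := by
    intro t
    rw [← Finset.mem_image, e.image_equiv]
    exact u.mem_face t
  choose v hv hvu using hmem
  have hinj : Function.Injective v := fun s t h => u.2.1 (by rw [← hvu, ← hvu, h])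
  have hsub : univ.image v ⊆ (e.equiv (u.face, a)).1 := by
    intro x hx
    obtain ⟨t, -, rfl⟩ := Finset.mem_image.1 hx
    exact hv t
  refine ⟨⟨v, hinj, (e.equiv (u.face, a)).2.1.mono hsub⟩, Subtype.ext (funext hvu), ?_⟩
  have hface : OrdSimplex.face ⟨v, hinj, (e.equiv (u.face, a)).2.1.mono hsub⟩ =
      e.equiv (u.face, a) := by
    apply Subtype.ext
    refine Finset.eq_of_subset_of_card_le hsub ?_
    exact (e.equiv (u.face, a)).2.2.trans_le (OrdSimplex.face _).2.2.ge
  unfold Sheets.sheet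
  rw [hface, Equiv.symm_apply_apply]

/-- Cochains of `M`, one for each index `j`, combined to a cochain of `K` that is, on the sheet `a`,
the combination with the coefficients `S a j`. -/
def Sheets.combine (S : Matrix (Fin k) (Fin k) ℂ) :
    (Fin k → Cochain ℂ M n) →ₗ[ℂ] Cochain ℂ K n where
  toFun f := ⟨fun v => ∑ j, S (e.sheet v) j * (f j).1 (v.push hφ), by
    intro v σ
    rw [Finset.mul_sum]
    refine Finset.sum_congr rfl fun j _ => ?_
    rw [e.sheet_reorder, OrdSimplex.push_reorder, (f j).2]
    ring⟩
  map_add' f g := by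
    apply Subtype.ext
    funext v
    simp [mul_add, Finset.sum_add_distrib]
  map_smul' c f := by
    apply Subtype.ext
    funext v
    simp only [Submodule.coe_smul, Pi.smul_apply, smul_eq_mul, RingHom.id_apply, Finset.mul_sum]
    exact Finset.sum_congr rfl fun j _ => by ring

theorem Sheets.combine_apply (S : Matrix (Fin k) (Fin k) ℂ) (f : Fin k → Cochain ℂ M n)
    (v : OrdSimplex K n) :
    (e.combine hφ S f).1 v = ∑ j, S (e.sheet v) j * (f j).1 (v.push hφ) := rfl

theorem Sheets.combine_bijective {S : Matrix (Fin k) (Fin k) ℂ} (hS : IsUnit S) :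
    Function.Bijective (e.combine hφ S) := by
  have hinj : Function.Injective (e.combine hφ S) := by
    rw [← LinearMap.ker_eq_bot, LinearMap.ker_eq_bot']
    intro f hf
    -- Since `u` lifts to every sheet, the vanishing of the combination says that `S` kills the
    -- vector of the values at `u`.
    have h0 : ∀ u : OrdSimplex M n, (fun j => (f j).1 u) = 0 := by
      intro u
      apply Matrix.mulVec_injective_of_isUnit hS
      rw [Matrix.mulVec_zero]
      funext a
      obtain ⟨v, rfl, rfl⟩ := e.exists_lift hφ u a
      exact congrFun (congrArg Subtype.val hf) v
    funext j
    apply Subtype.ext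
    funext u
    exact congrFun (h0 u) j
  -- Both sides have dimension `k` times the number of faces of `M`, so injectivity suffices.
  refine ⟨hinj, (LinearMap.injective_iff_surjective_of_finrank_eq_finrank ?_).1 hinj⟩
  rw [Module.finrank_pi_fintype, Cochain.finrank ℂ K, Cochain.finrank ℂ M,
    ← Fintype.card_congr e.equiv]
  simp [mul_comm]

end Lift

/-! ### Intertwining the coboundaries and their adjoints -/

section Intertwine

variable {V W : Type*} [Fintype V] [DecidableEq V] [Fintype W] [DecidableEq W]
variable {K : PreAbstractSimplicialComplex V} {M : PreAbstractSimplicialComplex W} {φ : V → W}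
variable {n k : ℕ} (hφ : IsNondegenerate K M φ)
variable {ψ : Voltage (incidenceGraph M n) k}
variable {e : Sheets K M φ n k} {e' : Sheets K M φ (n + 1) k}

/-- The incidences between two families of sheets are those of the derived graph. -/
def IsDerived (ψ : Voltage (incidenceGraph M n) k) (e : Sheets K M φ n k)
    (e' : Sheets K M φ (n + 1) k) : Prop :=
  ∀ F a G b, (e.equiv (F, a)).1 ⊆ (e'.equiv (G, b)).1 ↔
    ∃ h : F.1 ⊆ G.1, a = ψ.incidence F G h b

/-- The weights given by a character of the voltage group are unitary. -/
theorem Voltage.weight_mul_conj (χ : ψ.group →* ℂˣ) (F : Face M n) (G : Face M (n + 1))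
    (h : F.1 ⊆ G.1) :
    (starRingEnd ℂ) ((ψ.weight χ).toFun F G) * (ψ.weight χ).toFun F G = 1 := by
  have hn : ‖((ψ.weight χ).toFun F G : ℂ)‖ = 1 := by
    simp only [Voltage.weight, dif_pos h]
    -- The voltage group is finite, so its characters take values in the roots of unity.
    refine Complex.norm_eq_one_of_pow_eq_one (n := Nat.card ψ.group) ?_ Nat.card_pos.ne'
    rw [← Units.val_pow_eq_pow_val, ← map_pow, pow_card_eq_one', map_one, Units.val_one]
  rw [mul_comm, Complex.mul_conj, Complex.normSq_eq_norm_sq, hn]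
  simp

/-- The rows of `S` indexed by `g b` and `b` differ by the values of the characters at `g`. -/
def IsEquivariant (H : Subgroup (Equiv.Perm (Fin k))) (ϱ : Fin k → (H →* ℂˣ))
    (S : Matrix (Fin k) (Fin k) ℂ) : Prop :=
  ∀ (g : H) b j, S ((g : Equiv.Perm (Fin k)) b) j = (ϱ j g : ℂ) * S b j

/-- Row `j` of `T⁻¹` is a left eigenvector of every `P^g`, with eigenvalue `ϱ j g`; right
multiplication by `P^g` replaces the column index `b` by `g b`. Transposing `T⁻¹` makes the sheet
the row index. -/
theorem IsDecomposition.exists_isEquivariant [NeZero k] {H : Subgroup (Equiv.Perm (Fin k))}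
    {ϱ : Fin k → (H →* ℂˣ)} (h : IsDecomposition H ϱ) :
    ∃ S : Matrix (Fin k) (Fin k) ℂ, IsUnit S ∧ IsEquivariant H ϱ S := by
  obtain ⟨-, T, hT, hg⟩ := h
  have hdet := (Matrix.isUnit_iff_isUnit_det _).1 hT
  refine ⟨T⁻¹.transpose, ?_, fun g b j => ?_⟩
  · rw [Matrix.isUnit_transpose]
    exact (Matrix.isUnit_nonsing_inv_iff).2 hT
  · have h1 : T⁻¹ * permMat (g : Equiv.Perm (Fin k)) =
        Matrix.diagonal (fun j => (ϱ j g : ℂ)) * T⁻¹ := by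
      rw [← hg g, mul_assoc, Matrix.mul_nonsing_inv _ hdet, mul_one]
    have h2 := congrFun (congrFun h1 j) b
    rw [Matrix.diagonal_mul, Matrix.mul_apply] at h2
    simpa [permMat_apply] using h2

variable {ϱ : Fin k → (ψ.group →* ℂˣ)} {S : Matrix (Fin k) (Fin k) ℂ}

theorem sheet_incident (hder : IsDerived ψ e e') {v : OrdSimplex K n} {x : OrdSimplex K (n + 1)}
    (h : v.face.1 ⊆ x.face.1) :
    ∃ h : (v.push hφ).face.1 ⊆ (x.push hφ).face.1,
      e.sheet v = ψ.incidence _ _ h (e'.sheet x) := by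
  rw [e.face_eq hφ, e'.face_eq hφ x] at h
  exact (hder _ _ _ _).1 h

/-- The key identity: passing from a simplex to a facet changes the sheet by the voltage, hence the
coefficient by exactly the weight of that incidence. -/
theorem coefficient_incident (hder : IsDerived ψ e e') (hS : IsEquivariant ψ.group ϱ S)
    {v : OrdSimplex K n} {x : OrdSimplex K (n + 1)} (h : v.face.1 ⊆ x.face.1) (j : Fin k) :
    S (e.sheet v) j =
      (ψ.weight (ϱ j)).toFun (v.push hφ).face (x.push hφ).face * S (e'.sheet x) j := by
  obtain ⟨h1, h2⟩ := sheet_incident hφ hder h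
  rw [h2]
  simp only [Voltage.weight, dif_pos h1]
  exact hS ⟨ψ.incidence _ _ h1, Subgroup.subset_closure ⟨_, _, h1, rfl⟩⟩ _ j

theorem coboundary_combine (hder : IsDerived ψ e e') (hS : IsEquivariant ψ.group ϱ S)
    (f : Fin k → Cochain ℂ M n) :
    coboundary (IncidenceWeight.one ℂ K n) (e.combine hφ S f) =
      e'.combine hφ S fun j => coboundary (ψ.weight (ϱ j)) (f j) := by
  apply Subtype.ext
  funext x
  rw [e'.combine_apply]
  simp only [coboundary, LinearMap.coe_mk, AddHom.coe_mk, e.combine_apply, Finset.mul_sum]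
  rw [Finset.sum_comm]
  refine Finset.sum_congr rfl fun j _ => Finset.sum_congr rfl fun t _ => ?_
  have hsub := x.face_omit_subset t
  rw [coefficient_incident hφ hder hS hsub, OrdSimplex.push_omit]
  simp only [IncidenceWeight.one, if_pos hsub]
  ring

/-- Pushing forward is a bijection from the ordered cofaces of `v` to those of its image: the
voltage of the incidence determines the sheet of the lift. Weight ratios agree under it, and the
conjugate weight in the adjoint cancels the weight from `coefficient_incident`. -/
theorem adjointCoboundary_combine (hder : IsDerived ψ e e') (hS : IsEquivariant ψ.group ϱ S)
    {wK : Finset V → ℝ} {wM : Finset W → ℝ}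
    (hw : ∀ F, IsFace K F → (F.card = n ∨ F.card = n + 1) → wK F = wM (F.image φ))
    (g : Fin k → Cochain ℂ M (n + 1)) :
    adjointCoboundary wK (IncidenceWeight.one ℂ K n) (e'.combine hφ S g) =
      e.combine hφ S fun j => adjointCoboundary wM (ψ.weight (ϱ j)) (g j) := by
  apply Subtype.ext
  funext v
  rw [e.combine_apply]
  simp only [adjointCoboundary, LinearMap.coe_mk, AddHom.coe_mk, e'.combine_apply, Finset.mul_sum]
  rw [Finset.sum_comm]
  refine Finset.sum_congr rfl fun j _ => ?_
  refine Finset.sum_bij (fun x _ => x.push hφ) ?_ ?_ ?_ ?_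
  · intro x hx
    simp only [Finset.mem_filter, mem_univ, true_and] at hx ⊢
    rw [← hx, OrdSimplex.push_omit]
  · intro x hx y hy hxy
    simp only [Finset.mem_filter, mem_univ, true_and] at hx hy
    have hvx : v.face.1 ⊆ x.face.1 := hx ▸ x.face_omit_subset 0
    have hvy : v.face.1 ⊆ y.face.1 := hy ▸ y.face_omit_subset 0
    obtain ⟨h1, h2⟩ := sheet_incident hφ hder hvx
    obtain ⟨h3, h4⟩ := sheet_incident hφ hder hvy
    -- Both cofaces have the same image and contain `v`, so one voltage permutation sends both of
    -- their sheets to that of `v`.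
    have hs : e'.sheet x = e'.sheet y := by
      apply (ψ.incidence _ _ h1).injective
      rw [← h2, h4]
      simp only [hxy]
    have hf : x.face = y.face := by
      rw [e'.face_eq hφ x, e'.face_eq hφ y, hs, hxy]
    exact OrdSimplex.push_inj hφ x.2.2 subset_rfl (hf ▸ subset_rfl) hxy
  · intro u hu
    simp only [Finset.mem_filter, mem_univ, true_and] at hu
    have h1 : (v.push hφ).face.1 ⊆ u.face.1 := hu ▸ u.face_omit_subset 0
    -- A lift containing `v` must lie in the sheet `b` with `ψ(F, G) b` equal to the sheet of `v`,
    -- hence the inverse voltage.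
    obtain ⟨x, hxu, hxs⟩ := e'.exists_lift hφ u ((ψ.incidence _ _ h1)⁻¹ (e.sheet v))
    have hvx : v.face.1 ⊆ x.face.1 := by
      rw [e.face_eq hφ v, e'.face_eq hφ x, hder, hxs, hxu]
      exact ⟨h1, by simp⟩
    refine ⟨x, ?_, hxu⟩
    simp only [Finset.mem_filter, mem_univ, true_and]
    refine OrdSimplex.push_inj hφ x.2.2 (x.face_omit_subset 0) hvx ?_
    rw [OrdSimplex.push_omit, hxu, hu]
  · intro x hx
    simp only [Finset.mem_filter, mem_univ, true_and] at hx
    have hvx : v.face.1 ⊆ x.face.1 := hx ▸ x.face_omit_subset 0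
    obtain ⟨h1, -⟩ := sheet_incident hφ hder hvx
    rw [coefficient_incident hφ hder hS hvx, OrdSimplex.push_face, OrdSimplex.push_face,
      hw _ x.face.2.1 (Or.inr x.face.2.2), hw _ v.face.2.1 (Or.inl v.face.2.2)]
    simp only [IncidenceWeight.one, if_pos hvx, map_one, mul_one]
    linear_combination (-((wM (x.face.1.image φ) / wM (v.face.1.image φ) : ℝ) : ℂ) *
      S (e'.sheet x) j * (g j).1 (x.push hφ)) * Voltage.weight_mul_conj (ϱ j) _ _ h1

/-- The characteristic polynomial of the lifted Laplacian. -/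
theorem charpoly_downLaplacian (hφ : IsNondegenerate K M φ) (hder : IsDerived ψ e e')
    (hS : IsEquivariant ψ.group ϱ S) (hSu : IsUnit S) {wK : Finset V → ℝ} {wM : Finset W → ℝ}
    (hw : ∀ F, IsFace K F → (F.card = n ∨ F.card = n + 1) → wK F = wM (F.image φ)) :
    (weightedDownLaplacian K n wK (IncidenceWeight.one ℂ K n)).charpoly =
      ∏ j, (weightedDownLaplacian M n wM (ψ.weight (ϱ j))).charpoly := by
  rw [← charpoly_pi]
  let E := LinearEquiv.ofBijective (e'.combine hφ S) (e'.combine_bijective hφ hSu)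
  rw [← LinearEquiv.charpoly_conj E]
  congr 1
  apply LinearMap.ext
  intro f
  obtain ⟨g, rfl⟩ := E.surjective f
  rw [LinearEquiv.conj_apply_apply, LinearEquiv.symm_apply_apply]
  change coboundary _ (adjointCoboundary wK _ (e'.combine hφ S g)) = _
  rw [adjointCoboundary_combine hφ hder hS hw, coboundary_combine hφ hder hS]
  rfl

end Intertwine

/-! ### From the derived graph to sheets, and from polynomials to spectra -/

section DerivedGraph

variable {V W : Type*} [Fintype V] [DecidableEq V] [Fintype W] [DecidableEq W]
variable {K : PreAbstractSimplicialComplex V} {M : PreAbstractSimplicialComplex W} {φ : V → W}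
variable {i k : ℕ}

theorem isFace_simplexOf (y : Face K i ⊕ Face K (i + 1)) : IsFace K (simplexOf y) := by
  rcases y with F | F
  · exact F.2.1
  · exact F.2.1

theorem simplexOf_injective :
    Function.Injective (simplexOf : Face K i ⊕ Face K (i + 1) → Finset V) := by
  rintro (F | F) (G | G) h <;> simp only [simplexOf] at h
  · exact congrArg _ (Subtype.ext h)
  · have := F.2.2.symm.trans ((congrArg Finset.card h).trans G.2.2)
    omega
  · have := F.2.2.symm.trans ((congrArg Finset.card h).trans G.2.2)
    omega
  · exact congrArg _ (Subtype.ext h)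

theorem incidenceGraph_inl_inr (F : Face K i) (G : Face K (i + 1)) :
    (incidenceGraph K i).Adj (.inl F) (.inr G) ↔ F.1 ⊆ G.1 := Iff.rfl

/-- A derived graph isomorphic to the incidence graph of `K` enumerates the faces of `K`. -/
theorem exists_sheets (hφ : IsNondegenerate K M φ) {ψ : Voltage (incidenceGraph M i) k}
    (η : derivedGraph ψ ≃g incidenceGraph K i)
    (hη : ∀ x, (simplexOf (η x)).image φ = simplexOf x.1) {n : ℕ}
    {f : Face M n → Face M i ⊕ Face M (i + 1)} {g : Face K n → Face K i ⊕ Face K (i + 1)}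
    (hf : ∀ G, simplexOf (f G) = G.1) (hg : ∀ F, simplexOf (g F) = F.1)
    (hfs : ∀ y, (simplexOf y).card = n → y ∈ Set.range f) :
    ∃ e : Sheets K M φ n k, ∀ G a, g (e.equiv (G, a)) = η (f G, a) := by
  -- As `φ` is injective on simplices, `η` preserves dimension, so it respects the two sides of the
  -- bipartite graphs and can be restricted to each.
  have hcard : ∀ x, (simplexOf (η x)).card = (simplexOf x.1).card := fun x => by
    rw [← hη, Finset.card_image_of_injOn (hφ.injOn _ (isFace_simplexOf _))]
  let h : Face M n × Fin k → Face K n := fun x =>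
    ⟨simplexOf (η (f x.1, x.2)), isFace_simplexOf _, by rw [hcard, hf, x.1.2.2]⟩
  have hh : ∀ x, g (h x) = η (f x.1, x.2) := fun x => simplexOf_injective (hg _)
  have hbij : Function.Bijective h := by
    constructor
    · rintro ⟨G, a⟩ ⟨G', a'⟩ he
      have h1 : η (f G, a) = η (f G', a') := by rw [← hh (G, a), he, hh]
      have h2 := Prod.ext_iff.1 (η.injective h1)
      refine Prod.ext (Subtype.ext ?_) h2.2
      rw [← hf, ← hf]
      exact congrArg simplexOf h2.1
    · intro F
      obtain ⟨G, hG⟩ := hfs (η.symm (g F)).1 (by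
        rw [← hcard, RelIso.apply_symm_apply, hg, F.2.2])
      refine ⟨(G, (η.symm (g F)).2), Subtype.ext ?_⟩
      change simplexOf (η (f G, (η.symm (g F)).2)) = F.1
      rw [hG, ← hg, Prod.mk.eta, RelIso.apply_symm_apply]
  exact ⟨⟨Equiv.ofBijective h hbij, fun x => (hη _).trans (hf _)⟩, fun G a => hh (G, a)⟩

theorem exists_isDerived (hφ : IsNondegenerate K M φ) {ψ : Voltage (incidenceGraph M i) k}
    (η : derivedGraph ψ ≃g incidenceGraph K i)
    (hη : ∀ x, (simplexOf (η x)).image φ = simplexOf x.1) :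
    ∃ (e : Sheets K M φ i k) (e' : Sheets K M φ (i + 1) k), IsDerived ψ e e' := by
  obtain ⟨e, he⟩ := exists_sheets hφ η hη (f := Sum.inl) (g := Sum.inl) (fun _ => rfl)
    (fun _ => rfl) (by
      rintro (G | G) h
      · exact ⟨G, rfl⟩
      · have := G.2.2.symm.trans h
        omega)
  obtain ⟨e', he'⟩ := exists_sheets hφ η hη (f := Sum.inr) (g := Sum.inr) (fun _ => rfl)
    (fun _ => rfl) (by
      rintro (G | G) h
      · have := G.2.2.symm.trans h
        omega
      · exact ⟨G, rfl⟩)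
  -- Adjacency in the derived graph, read along the arc from `F` to `G`, is exactly the condition in
  -- `IsDerived`.
  refine ⟨e, e', fun F a G b => ?_⟩
  rw [← incidenceGraph_inl_inr, he, he', η.map_adj_iff]
  rfl

theorem Voltage.weight_one (ψ : Voltage (incidenceGraph M i) k) :
    ψ.weight 1 = IncidenceWeight.one ℂ M i := by
  have h : (ψ.weight 1).toFun = (IncidenceWeight.one ℂ M i).toFun := by
    funext F G
    by_cases h : F.1 ⊆ G.1 <;> simp [Voltage.weight, IncidenceWeight.one, h]
  cases h1 : ψ.weight 1
  cases h2 : IncidenceWeight.one ℂ M i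
  simpa [h1, h2] using h

/-- The spectrum of an operator whose characteristic polynomial factors. -/
theorem spec_eq_sum {ι E : Type*} {F : ι → Type*} [AddCommGroup E] [Module ℂ E] [Module.Finite ℂ E]
    [∀ j, AddCommGroup (F j)] [∀ j, Module ℂ (F j)] [∀ j, Module.Finite ℂ (F j)]
    {A : Module.End ℂ E} {B : ∀ j, Module.End ℂ (F j)} {s : Finset ι}
    (h : A.charpoly = ∏ j ∈ s, (B j).charpoly) : spec A = ∑ j ∈ s, spec (B j) := by
  unfold spec
  rw [h]
  simp only [Polynomial.aroots, Polynomial.map_prod]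
  rw [Polynomial.roots_prod]
  · rfl
  · exact Finset.prod_ne_zero_iff.2 fun j _ => ((LinearMap.charpoly_monic _).map _).ne_zero

end DerivedGraph

end CoverSpec

end

theorem mainTheorem8 {V W : Type*} [Fintype V] [DecidableEq V] [Fintype W] [DecidableEq W]
    (K : PreAbstractSimplicialComplex V) (M : PreAbstractSimplicialComplex W) (φ : V → W)
    (k : ℕ) [NeZero k] (hφ : CoverSpec.IsFoldCovering k K M φ)
    (wK : Finset V → ℝ) (wM : Finset W → ℝ)
    (hwK : ∀ F, CoverSpec.IsFace K F → 0 < wK F) (hwM : ∀ G, CoverSpec.IsFace M G → 0 < wM G)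
    (i : ℕ)
    (hw : ∀ F, CoverSpec.IsFace K F → (F.card = i ∨ F.card = i + 1) → wK F = wM (F.image φ))
    (ψ : CoverSpec.Voltage (CoverSpec.incidenceGraph M i) k)
    (η : CoverSpec.derivedGraph ψ ≃g CoverSpec.incidenceGraph K i)
    (hη : ∀ x, (CoverSpec.simplexOf (η x)).image φ = CoverSpec.simplexOf x.1)
    (hab : ∀ a ∈ ψ.group, ∀ b ∈ ψ.group, a * b = b * a) :
    (∃ ϱ : Fin k → (ψ.group →* ℂˣ), CoverSpec.IsDecomposition ψ.group ϱ) ∧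
    ∀ ϱ : Fin k → (ψ.group →* ℂˣ), CoverSpec.IsDecomposition ψ.group ϱ →
      CoverSpec.spec (CoverSpec.downLaplacian K i wK) =
        CoverSpec.spec (CoverSpec.downLaplacian M i wM) +
          ∑ j ∈ Finset.univ.erase (0 : Fin k),
            CoverSpec.spec (CoverSpec.weightedDownLaplacian M i wM (ψ.weight (ϱ j))) := by
  refine ⟨CoverSpec.exists_isDecomposition _ hab, fun ϱ hϱ => ?_⟩
  have hnd := hφ.toIsCovering.isNondegenerate
  obtain ⟨e, e', hder⟩ := CoverSpec.exists_isDerived hnd η hη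
  obtain ⟨S, hSu, hS⟩ := hϱ.exists_isEquivariant
  rw [CoverSpec.spec_downLaplacian, CoverSpec.spec_downLaplacian,
    CoverSpec.spec_eq_sum (CoverSpec.charpoly_downLaplacian hnd hder hS hSu hw),
    ← Finset.add_sum_erase _ _ (Finset.mem_univ (0 : Fin k)), hϱ.1, ψ.weight_one]
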